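/- Let $S$ be a Polish space with Borel $\sigma$-algebra $\mathcal B$, let $I\neq\emptyset$ be an arbitrary index set and let $\mathscr H$ be the set of all finite nonempty subsets of $I$. For $J\in\mathscr H$ let $\mathcal B^J$ be the product $\sigma$-algebra on $S^J$, and let $\mathcal B^I$ be the product $\sigma$-algebra on $S^I$. For $K\subset J$ in $\mathscr H$ let $\mathrm{pr}_{JK}\colon S^J\to S^K$ and $\mathrm{pr}_J\colon S^I\to S^J$ be the canonical projections. Write $\mathcal L^\infty(\Omega,\mathcal F)$ for the space of all bounded $\mathcal F$-measurable functions $\Omega\to\mathbb R$ with the supremum norm and the pointwise order. For every $J\in\mathscr H$ let $M_J\subset\mathcal L^\infty(S^J,\mathcal B^J)$ be a linear subspace that contains the constant function $1$, is closed under pointwise minima and maxima (a Riesz subspace), and generates the $\sigma$-algebra: $\sigma(M_J)=\mathcal B^J$. Assume that $f\circ\mathrm{pr}_{JK}\in M_J$ for all $f\in M_K$ and all $K\subset J$ in $\mathscr H$. Let $(M_J)'$ be the topological dual of $(M_J,\|\cdot\|_\infty)$ with the weak* topology, and let $[(M_J)']^1_+$ be the set of all linear pre-expectations on $M_J$, that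 is, of all linear $\mu\colon M_J\to\mathbb R$ with $\mu(f)\le\mu(g)$ whenever $f\le g$, and $\mu(\alpha)=\alpha$ for all constants $\alpha\in\mathbb R$ (such $\mu$ are automatically bounded). For every $J\in\mathscr H$ let $\mathcal Q_J\subset[(M_J)']^1_+$ be convex and weak* compact, and suppose that every $\mu\in\mathcal Q_J$ is continuous from above: $\mu(f_n)\searrow\mu(f)$ whenever $f_n,f\in M_J$ and $f_n\searrow f$ pointwise. Suppose that the family $(\mathcal Q_J)_{J\in\mathscr H}$ is consistent: for all $K\subset J$ in $\mathscr H$, $$\{\mu\circ\mathrm{pr}_{JK}^{-1}\colon \mu\in\mathcal Q_J\}=\mathcal Q_K,\qquad (\mu\circ\mathrm{pr}_{JK}^{-1})(f):=\mu(f\circ\mathrm{pr}_{JK})\ \text{ for } f\in M_K.$$ Then there exists a set $\mathcal Q$ of countably additive probability measures on $(S^I,\mathcal B^I)$ such that $\mathcal Q\circ\mathrm{pr}_J^{-1}=\mathcal Q_J$ for all $J\in\mathscr H$, that is, for every $J\in\mathscr H$ the set of functionals $$M_J\to\mathbb R,\quad f\mapsto\int_{S^I} f\circ\mathrm{pr}_J\,d\nu,\qquad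 \nu\in\mathcal Q,$$ is equal to $\mathcal Q_J$. -/

import Mathlib

open MeasureTheory Set Filter Topology
open scoped ENNReal

namespace RobustKolmogorov

noncomputable section

/-- The bounded measurable functions `Ω → ℝ`, as a subspace of the space of all bounded functions
`Ω → ℝ` with the supremum norm. No functions are identified. -/
def boundedMeasurable (Ω : Type*) [MeasurableSpace Ω] :
    Submodule ℝ (lp (fun _ : Ω => ℝ) ∞) where
  carrier := {f | Measurable (f : Ω → ℝ)}
  add_mem' := by
    intro f g hf hg
    simp only [mem_ofPred_eq] at hf hg ⊢
    rw [lp.coeFn_add]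
    exact hf.add hg
  zero_mem' := by
    simp only [mem_ofPred_eq]
    rw [lp.coeFn_zero]
    exact measurable_const
  smul_mem' := by
    intro c f hf
    simp only [mem_ofPred_eq] at hf ⊢
    rw [lp.coeFn_smul]
    exact hf.const_smul c

/-- `ℒ^∞(Ω, 𝓕)` with the supremum norm. -/
abbrev LInfty (Ω : Type*) [MeasurableSpace Ω] : Type _ := boundedMeasurable Ω

section General

variable {Ω Ω' : Type*} [MeasurableSpace Ω] [MeasurableSpace Ω']

instance : CoeFun (LInfty Ω) (fun _ => Ω → ℝ) := ⟨fun f => (f.1 : Ω → ℝ)⟩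

/-- Build an element of `ℒ^∞` from a bounded measurable function. -/
def LInfty.mk (f : Ω → ℝ) (hf : Measurable f) (hb : ∃ C, ∀ ω, |f ω| ≤ C) : LInfty Ω :=
  ⟨⟨f, memℓp_infty (by
    obtain ⟨C, hC⟩ := hb
    exact ⟨C, by rintro _ ⟨ω, rfl⟩; simpa [Real.norm_eq_abs] using hC ω⟩)⟩, hf⟩

@[simp] theorem LInfty.mk_apply (f : Ω → ℝ) (hf : Measurable f) (hb : ∃ C, ∀ ω, |f ω| ≤ C)
    (ω : Ω) : LInfty.mk f hf hb ω = f ω := rfl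

theorem LInfty.ext {f g : LInfty Ω} (h : ∀ ω, f ω = g ω) : f = g :=
  Subtype.ext (lp.ext (funext h))

theorem LInfty.measurable (f : LInfty Ω) : Measurable (f : Ω → ℝ) := f.2

theorem LInfty.abs_apply_le (f : LInfty Ω) (ω : Ω) : |f ω| ≤ ‖f‖ :=
  lp.norm_apply_le_norm ENNReal.top_ne_zero f.1 ω

theorem LInfty.norm_le {f : LInfty Ω} {C : ℝ} (hC : 0 ≤ C) (h : ∀ ω, |f ω| ≤ C) : ‖f‖ ≤ C :=
  lp.norm_le_of_forall_le hC h

@[simp] theorem LInfty.add_apply (f g : LInfty Ω) (ω : Ω) : (f + g : LInfty Ω) ω = f ω + g ω := rfl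

@[simp] theorem LInfty.smul_apply (c : ℝ) (f : LInfty Ω) (ω : Ω) :
    (c • f : LInfty Ω) ω = c * f ω := rfl

/-- The constant function `α` on `Ω`. -/
def LInfty.const (Ω : Type*) [MeasurableSpace Ω] (α : ℝ) : LInfty Ω :=
  LInfty.mk (fun _ => α) measurable_const ⟨|α|, fun _ => le_rfl⟩

/-- The composition operator `f ↦ f ∘ φ` with a measurable map `φ : Ω → Ω'`. -/
def LInfty.comp (φ : Ω → Ω') (hφ : Measurable φ) : LInfty Ω' →L[ℝ] LInfty Ω :=
  LinearMap.mkContinuous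
    { toFun := fun f => LInfty.mk (fun ω => f (φ ω)) (f.measurable.comp hφ)
        ⟨‖f‖, fun ω => f.abs_apply_le (φ ω)⟩
      map_add' := fun _ _ => LInfty.ext fun _ => rfl
      map_smul' := fun _ _ => LInfty.ext fun _ => rfl }
    1 (fun f => by
      rw [one_mul]
      exact LInfty.norm_le (norm_nonneg _) fun ω => f.abs_apply_le (φ ω))

@[simp] theorem LInfty.comp_apply (φ : Ω → Ω') (hφ : Measurable φ) (f : LInfty Ω') (ω : Ω) :
    LInfty.comp φ hφ f ω = f (φ ω) := rfl

theorem LInfty.integrable (ν : ProbabilityMeasure Ω) (f : LInfty Ω) :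
    Integrable (f : Ω → ℝ) (ν : Measure Ω) :=
  Integrable.of_bound f.measurable.aestronglyMeasurable ‖f‖ (ae_of_all _ f.abs_apply_le)

/-- A countably additive probability measure `ν`, seen as the bounded linear functional
`f ↦ ∫ f dν` on `ℒ^∞`. -/
def expectation (ν : ProbabilityMeasure Ω) : LInfty Ω →L[ℝ] ℝ :=
  LinearMap.mkContinuous
    { toFun := fun f => ∫ ω, f ω ∂(ν : Measure Ω)
      map_add' := fun f g => integral_add (f.integrable ν) (g.integrable ν)
      map_smul' := fun c f => integral_const_mul c (f : Ω → ℝ) }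
    1 (fun f => by
      have h := norm_integral_le_of_norm_le_const (μ := (ν : Measure Ω)) (f := (f : Ω → ℝ))
        (C := ‖f‖) (ae_of_all _ f.abs_apply_le)
      rw [probReal_univ, mul_one] at h
      rw [one_mul]
      exact h)

@[simp] theorem expectation_apply (ν : ProbabilityMeasure Ω) (f : LInfty Ω) :
    expectation ν f = ∫ ω, f ω ∂(ν : Measure Ω) := rfl

/-- A linear subspace of `ℒ^∞` is a Riesz subspace if it is closed under pointwise minima
and maxima. -/
def IsRieszSubspace (M : Submodule ℝ (LInfty Ω)) : Prop :=
  ∀ f ∈ M, ∀ g ∈ M,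
    (∃ h ∈ M, ∀ ω, h ω = min (f ω) (g ω)) ∧ (∃ h ∈ M, ∀ ω, h ω = max (f ω) (g ω))

/-- The σ-algebra `σ(M)` generated by the functions in `M`. -/
abbrev generatedSigma (M : Submodule ℝ (LInfty Ω)) : MeasurableSpace Ω :=
  ⨆ f ∈ M, MeasurableSpace.comap (f : Ω → ℝ) (borel ℝ)

/-- A (nonlinear) pre-expectation on `M`: a monotone and constant preserving functional. -/
structure IsPreExpectation {M : Submodule ℝ (LInfty Ω)} (E : M → ℝ) : Prop where
  mono : ∀ X Y : M, (∀ ω, (X : LInfty Ω) ω ≤ (Y : LInfty Ω) ω) → E X ≤ E Y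
  const : ∀ (α : ℝ) (h : LInfty.const Ω α ∈ M), E ⟨LInfty.const Ω α, h⟩ = α

/-- Continuity from above: `X n ↘ X` pointwise, with all of them in `M`, implies
`E (X n) ↘ E X`. -/
def ContinuousFromAbove {M : Submodule ℝ (LInfty Ω)} (E : M → ℝ) : Prop :=
  ∀ (X : ℕ → M) (Y : M),
    (∀ ω, Antitone (fun n => (X n : LInfty Ω) ω)) →
    (∀ ω, Tendsto (fun n => (X n : LInfty Ω) ω) atTop (𝓝 ((Y : LInfty Ω) ω))) →
    Antitone (fun n => E (X n)) ∧ Tendsto (fun n => E (X n)) atTop (𝓝 (E Y))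

/-- The set of all linear pre-expectations on `M`, inside the dual `M'` of `M` (for the supremum
norm). `WeakDual` carries the weak-* topology. -/
def linearPreExpectations (M : Submodule ℝ (LInfty Ω)) : Set (WeakDual ℝ M) :=
  {μ | IsPreExpectation (fun X : M => μ X)}

/-- For `φ : Ω → Ω'` with `N ∘ φ ⊆ M` and `μ ∈ M'`, the functional `μ ∘ φ⁻¹ ∈ N'` given by
`f ↦ μ (f ∘ φ)`. -/
def pushDual (φ : Ω → Ω') (hφ : Measurable φ) {M : Submodule ℝ (LInfty Ω)}
    {N : Submodule ℝ (LInfty Ω')} (h : ∀ f ∈ N, LInfty.comp φ hφ f ∈ M) (μ : WeakDual ℝ M) :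
    WeakDual ℝ N :=
  StrongDual.toWeakDual ((WeakDual.toStrongDual μ).comp
    (((LInfty.comp φ hφ).comp N.subtypeL).codRestrict M (fun f => h f.1 f.2)))

@[simp] theorem pushDual_apply (φ : Ω → Ω') (hφ : Measurable φ) {M : Submodule ℝ (LInfty Ω)}
    {N : Submodule ℝ (LInfty Ω')} (h : ∀ f ∈ N, LInfty.comp φ hφ f ∈ M) (μ : WeakDual ℝ M)
    (f : N) : pushDual φ hφ h μ f = μ ⟨LInfty.comp φ hφ f.1, h f.1 f.2⟩ := rfl

/-- For a probability measure `ν` on `Ω` and `φ : Ω → Ω'`, the functional `ν ∘ φ⁻¹` on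
`N ⊆ ℒ^∞(Ω')` given by `f ↦ ∫ f ∘ φ dν`. -/
def pushMeasure (φ : Ω → Ω') (hφ : Measurable φ) (N : Submodule ℝ (LInfty Ω'))
    (ν : ProbabilityMeasure Ω) : WeakDual ℝ N :=
  StrongDual.toWeakDual ((expectation ν).comp ((LInfty.comp φ hφ).comp N.subtypeL))

@[simp] theorem pushMeasure_apply (φ : Ω → Ω') (hφ : Measurable φ) (N : Submodule ℝ (LInfty Ω'))
    (ν : ProbabilityMeasure Ω) (f : N) :
    pushMeasure φ hφ N ν f = ∫ ω, (f : LInfty Ω') (φ ω) ∂(ν : Measure Ω) := rfl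

end General

section Kolmogorov

variable {I S : Type*} [MeasurableSpace S]

/-- The finite nonempty subsets of `I`, ordered by inclusion. -/
abbrev FinIdx (I : Type*) : Type _ := {J : Finset I // J.Nonempty}

/-- `S^J`, with the product σ-algebra. -/
abbrev FinPow (S : Type*) (J : FinIdx I) : Type _ := J.1 → S

/-- The projection `pr_J : S^I → S^J`. -/
abbrev pr (S : Type*) (J : FinIdx I) : (I → S) → FinPow S J := J.1.restrict

/-- The projection `pr_{JK} : S^J → S^K` for `K ⊆ J`. -/
abbrev pr₂ (S : Type*) {J K : FinIdx I} (h : K ≤ J) : FinPow S J → FinPow S K :=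
  Finset.restrict₂ (π := fun _ => S) h

theorem measurable_pr (J : FinIdx I) : Measurable (pr S J) := Finset.measurable_restrict J.1

theorem measurable_pr₂ {J K : FinIdx I} (h : K ≤ J) : Measurable (pr₂ S h) :=
  Finset.measurable_restrict₂ h

/-- The family `M` satisfies `M_K ∘ pr_{JK} ⊆ M_J` for all `K ⊆ J`. -/
def StableUnderProj (M : ∀ J : FinIdx I, Submodule ℝ (LInfty (FinPow S J))) : Prop :=
  ∀ (J K : FinIdx I) (h : K ≤ J), ∀ f ∈ M K, LInfty.comp (pr₂ S h) (measurable_pr₂ h) f ∈ M J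

/-- The family `Q` is consistent: `Q_J ∘ pr_{JK}⁻¹ = Q_K` for all `K ⊆ J`. -/
def ConsistentSets {M : ∀ J : FinIdx I, Submodule ℝ (LInfty (FinPow S J))} (hM : StableUnderProj M)
    (Q : ∀ J : FinIdx I, Set (WeakDual ℝ (M J))) : Prop :=
  ∀ (J K : FinIdx I) (h : K ≤ J), pushDual (pr₂ S h) (measurable_pr₂ h) (hM J K h) '' Q J = Q K

end Kolmogorov

end

end RobustKolmogorov

open RobustKolmogorov

/-! Take for the set of measures all laws on `I → S` whose functional on `M J` lies in `Q J` for
every `J`. The only issue is that each `μ₀ ∈ Q J₀` is reached. Weak* compactness and consistency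
extend `μ₀` to a coherent family `x J ∈ Q J`: by Tychonoff, the families coherent below a given
index form a directed system of nonempty compact sets (`exists_consistent_family`). Continuity from
above makes each `x J` a Daniell integral, hence integration against a probability measure `ν J`
(`IsDaniell.exists_measure`). A generating Riesz space determines a probability measure, so
coherence of the functionals on the small spaces `M J` upgrades to coherence of the `ν J`
(`probabilityMeasure_eq_of_forall_integral_eq`). Kolmogorov's theorem then yields one law with
marginals `ν J` (`exists_isProjectiveLimit`), which rests on inner regularity of finite measures on
Polish spaces. -/

section KolmogorovExtension

/-! ### Kolmogorov extension over Polish spaces -/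

variable {ι : Type*} {α : ι → Type*} [∀ i, TopologicalSpace (α i)] 
/-- A sequence of points whose projections are eventually in the compact sets `K k` has a cluster
point whose projections all lie in these sets. -/
theorem nonempty_iInter_cylinder_of_isCompact [∀ i, T2Space (α i)] {J : ℕ → Finset ι}
    {K : ∀ n, Set (∀ j : J n, α j)} (hK : ∀ n, IsCompact (K n))
    (hne : ∀ n, (⋂ k ≤ n, cylinder (J k) (K k)).Nonempty) :
    (⋂ n, cylinder (J n) (K n)).Nonempty := by
  classical
  choose x hx using hne
  simp only [mem_iInter] at hx
  -- A single ultrafilter serves all `k`, so the limits are automatically compatible and no diagonal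
  -- subsequence is needed.
  have hlim : ∀ k, ∃ y ∈ K k,
      Tendsto (fun n => (J k).restrict (x n)) (hyperfilter ℕ : Filter ℕ) (𝓝 y) := by
    intro k
    have h := (hK k).ultrafilter_le_nhds ((hyperfilter ℕ).map fun n => (J k).restrict (x n)) (by
      rw [le_principal_iff, Ultrafilter.mem_coe, Ultrafilter.mem_map]
      refine Nat.hyperfilter_le_atTop ?_
      filter_upwards [eventually_ge_atTop k] with n hn using hx n k hn)
    exact h
  choose y hyK hy using hlim
  -- Coordinates outside every `J k` are irrelevant, and `x 0 i` is a default. Elsewhere the choice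
  -- of `k` does not matter, by uniqueness of limits.
  let z : ∀ i, α i := fun i =>
    if h : ∃ k, i ∈ J k then y h.choose ⟨i, h.choose_spec⟩ else x 0 i
  refine ⟨z, mem_iInter.2 fun k => ?_⟩
  have : (J k).restrict z = y k := by
    funext i
    have h : ∃ k, (i : ι) ∈ J k := ⟨k, i.2⟩
    have h1 := tendsto_pi_nhds.1 (hy k) i
    have h2 := tendsto_pi_nhds.1 (hy h.choose) ⟨i, h.choose_spec⟩
    have h3 : z i = y h.choose ⟨i, h.choose_spec⟩ := dif_pos h
    exact h3.trans (tendsto_nhds_unique h2 h1)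
  rw [mem_cylinder, this]
  exact hyK k

variable [∀ i, PolishSpace (α i)] [∀ i, MeasurableSpace (α i)] [∀ i, BorelSpace (α i)]

/-- The content of a projective family of finite measures on Polish spaces is continuous
at `∅`. -/
theorem projectiveFamilyContent_tendsto_zero {P : ∀ J : Finset ι, Measure (∀ j : J, α j)}
    [∀ J, IsFiniteMeasure (P J)] (hP : IsProjectiveMeasureFamily P)
    ⦃A : ℕ → Set (∀ i, α i)⦄ (hA : ∀ n, A n ∈ measurableCylinders α) (hanti : Antitone A)
    (hempty : ⋂ n, A n = ∅) :
    Tendsto (fun n => projectiveFamilyContent hP (A n)) atTop (𝓝 0) := by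
  rw [ENNReal.tendsto_atTop_zero]
  intro ε hε
  by_contra! hcon
  have hge : ∀ n, ε ≤ projectiveFamilyContent hP (A n) := fun n => by
    obtain ⟨m, hm, h⟩ := hcon n
    exact h.le.trans (projectiveFamilyContent_mono hP (hA m) (hA n) (hanti hm))
  choose J B hB hAB using fun n => (mem_measurableCylinders (A n)).1 (hA n)
  -- The total mass lost by passing to compact bases stays below `ε`, so it cannot exhaust any `A
  -- n`.
  obtain ⟨δ, hδ, hδsum⟩ := ENNReal.exists_pos_sum_of_countable' hε.ne' ℕ
  have hKex : ∀ n, ∃ K ⊆ B n, IsCompact K ∧ P (J n) (B n \ K) < δ n := fun n =>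
    (hB n).exists_isCompact_sdiff_lt (measure_ne_top _ _) (hδ n).ne'
  choose K hKB hKc hKlt using hKex
  have hCA : ∀ n, cylinder (J n) (K n) ⊆ A n := fun n => by
    rw [hAB n]; exact preimage_mono (hKB n)
  have hD : ∀ n, A n \ cylinder (J n) (K n) = cylinder (J n) (B n \ K n) := fun n => by
    rw [hAB n]; rfl
  have hDm : ∀ n, A n \ cylinder (J n) (K n) ∈ measurableCylinders α := fun n => by
    rw [hD n]
    exact cylinder_mem_measurableCylinders _ _ ((hB n).diff (hKc n).measurableSet)
  have hDlt : ∀ n, projectiveFamilyContent hP (A n \ cylinder (J n) (K n)) < δ n := fun n => by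
    rw [hD n, projectiveFamilyContent_cylinder hP ((hB n).diff (hKc n).measurableSet)]
    exact hKlt n
  -- If the first `n + 1` compact cylinders had empty intersection, the discarded pieces would cover
  -- `A n`, whose content is at least `ε`.
  obtain ⟨x, hx⟩ := nonempty_iInter_cylinder_of_isCompact hKc fun n => by
    by_contra! hemp
    have hsub : A n ⊆ ⋃ i ≤ n, A i \ cylinder (J i) (K i) := by
      intro x hx
      have : x ∉ ⋂ k ≤ n, cylinder (J k) (K k) := by rw [hemp]; exact notMem_empty x
      simp only [mem_iInter, not_forall] at this
      obtain ⟨k, hk, hxk⟩ := this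
      exact mem_iUnion₂.2 ⟨k, hk, hanti hk hx, hxk⟩
    have hU : (⋃ i ≤ n, A i \ cylinder (J i) (K i)) ∈ measurableCylinders α := by
      have := isSetRing_measurableCylinders.biUnion_mem (Finset.range (n + 1))
        (s := fun i => A i \ cylinder (J i) (K i)) (fun i _ => hDm i)
      simpa only [Finset.mem_range_succ_iff] using this
    have : ε ≤ ∑ i ∈ Finset.range (n + 1), δ i := calc
      ε ≤ projectiveFamilyContent hP (A n) := hge n
      _ ≤ _ := projectiveFamilyContent_mono hP (hA n) hU hsub
      _ ≤ _ := projectiveFamilyContent_iUnion_le hP hDm n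
      _ ≤ _ := Finset.sum_le_sum fun i _ => (hDlt i).le
    exact absurd hδsum (not_lt.2 (this.trans (ENNReal.sum_le_tsum _)))
  have : x ∈ ⋂ n, A n := mem_iInter.2 fun n => hCA n (mem_iInter.1 hx n)
  rw [hempty] at this
  exact this

/-- **Kolmogorov extension theorem** for Polish spaces. -/
theorem exists_isProjectiveLimit {P : ∀ J : Finset ι, Measure (∀ j : J, α j)}
    [∀ J, IsFiniteMeasure (P J)] (hP : IsProjectiveMeasureFamily P) :
    ∃ μ : Measure (∀ i, α i), IsProjectiveLimit μ P := by
  have hsub : (projectiveFamilyContent hP).IsSigmaSubadditive :=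
    isSigmaSubadditive_of_addContent_iUnion_eq_tsum isSetRing_measurableCylinders
      fun f hf hU hdisj => addContent_iUnion_eq_sum_of_tendsto_zero isSetRing_measurableCylinders
        (projectiveFamilyContent hP) (fun _ _ => projectiveFamilyContent_ne_top hP)
        (projectiveFamilyContent_tendsto_zero hP) hf hU hdisj
  refine ⟨(projectiveFamilyContent hP).measure isSetSemiring_measurableCylinders
    generateFrom_measurableCylinders.ge hsub, fun J => ?_⟩
  ext s hs
  rw [Measure.map_apply (Finset.measurable_restrict J) hs, AddContent.measure_eq, ← cylinder,
    projectiveFamilyContent_cylinder hP hs]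
  · exact generateFrom_measurableCylinders.symm
  · exact cylinder_mem_measurableCylinders _ _ hs

end KolmogorovExtension

/-! ### Daniell integrals and their measures -/

section Daniell

variable {Ω : Type*}

/-- An increasing sequence of nonnegative functions of `V` which reaches `1` at each point
of `A`. -/
structure IsMonotoneCover (V : Submodule ℝ (Ω → ℝ)) (A : Set Ω) (F : ℕ → Ω → ℝ) : Prop where
  mem : ∀ n, F n ∈ V
  nonneg : ∀ n, 0 ≤ F n
  mono : Monotone F
  one_le : ∀ ω ∈ A, ∃ n, 1 ≤ F n ω

/-- A Daniell integral of total mass one: a linear functional which is positive and continuous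
at `0` on the Stonean vector lattice `V` of functions. -/
structure IsDaniell (V : Submodule ℝ (Ω → ℝ)) (E : (Ω → ℝ) →ₗ[ℝ] ℝ) : Prop where
  one_mem : (1 : Ω → ℝ) ∈ V
  inf_mem : ∀ f ∈ V, ∀ g ∈ V, f ⊓ g ∈ V
  sup_mem : ∀ f ∈ V, ∀ g ∈ V, f ⊔ g ∈ V
  map_nonneg : ∀ f ∈ V, 0 ≤ f → 0 ≤ E f
  map_one : E 1 = 1
  tendsto_zero : ∀ f : ℕ → Ω → ℝ, (∀ n, f n ∈ V) → Antitone f →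
    (∀ ω, Tendsto (fun n => f n ω) atTop (𝓝 0)) → Tendsto (fun n => E (f n)) atTop (𝓝 0)

/-- The outer measure of a Daniell integral. -/
noncomputable def daniellOuter (V : Submodule ℝ (Ω → ℝ)) (E : (Ω → ℝ) →ₗ[ℝ] ℝ) :
    OuterMeasure Ω where
  measureOf A := ⨅ (F : ℕ → Ω → ℝ) (_ : IsMonotoneCover V A F), ⨆ n, ENNReal.ofReal (E (F n))
  empty := by
    refine le_antisymm (iInf₂_le_of_le (fun _ => 0)
      ⟨fun _ => V.zero_mem, fun _ => le_rfl, monotone_const, by simp⟩ (by simp)) zero_le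
  mono {A B} hAB := le_iInf₂ fun F hF =>
    iInf₂_le F ⟨hF.mem, hF.nonneg, hF.mono, fun ω hω => hF.one_le ω (hAB hω)⟩
  iUnion_nat s _ := by
    refine ENNReal.le_of_forall_pos_le_add fun ε hε hfin => ?_
    obtain ⟨δ, hδ, hδsum⟩ := ENNReal.exists_pos_sum_of_countable
      (ENNReal.coe_pos.2 hε).ne' ℕ
    have hex : ∀ i, ∃ F, IsMonotoneCover V (s i) F ∧ ⨆ n, ENNReal.ofReal (E (F n)) ≤
        (⨅ (F : ℕ → Ω → ℝ) (_ : IsMonotoneCover V (s i) F), ⨆ n, ENNReal.ofReal (E (F n)))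
          + δ i := by
      intro i
      have hlt := ENNReal.lt_add_right ((ENNReal.le_tsum i).trans_lt hfin).ne
        (ENNReal.coe_pos.2 (hδ i)).ne'
      obtain ⟨F, hF⟩ := iInf_lt_iff.1 hlt
      obtain ⟨hF, hF'⟩ := iInf_lt_iff.1 hF
      exact ⟨F, hF, hF'.le⟩
    choose F hF hle using hex
    -- Diagonal sum of the covers: step `n` uses the `n`-th terms of the first `n` of them, which
    -- stays inside `V` and is monotone.
    refine iInf₂_le_of_le (fun n => ∑ i ∈ Finset.range n, F i n)
      ⟨fun n => V.sum_mem fun i _ => (hF i).mem n,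
        fun n => Finset.sum_nonneg fun i _ => (hF i).nonneg n, fun m n hmn => ?_, ?_⟩ ?_
    · exact (Finset.sum_le_sum fun i _ => (hF i).mono hmn).trans
        (Finset.sum_le_sum_of_subset_of_nonneg (Finset.range_mono hmn)
          fun i _ _ => (hF i).nonneg n)
    · intro ω hω
      obtain ⟨i, hi⟩ := mem_iUnion.1 hω
      obtain ⟨n, hn⟩ := (hF i).one_le ω hi
      refine ⟨max n (i + 1), ?_⟩
      rw [Finset.sum_apply]
      refine (hn.trans ((hF i).mono (le_max_left n (i + 1)) ω)).trans
        (Finset.single_le_sum (f := fun j => F j (max n (i + 1)) ω)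
          (fun j _ => (hF j).nonneg _ ω) (Finset.mem_range.2 ?_))
      omega
    · refine iSup_le fun n => ?_
      rw [map_sum]
      calc ENNReal.ofReal (∑ i ∈ Finset.range n, E (F i n))
          ≤ ∑ i ∈ Finset.range n, ENNReal.ofReal (E (F i n)) := by
            apply Finset.le_sum_of_subadditive _ ENNReal.ofReal_zero.le
              (fun _ _ => ENNReal.ofReal_add_le)
        _ ≤ ∑ i ∈ Finset.range n, ((⨅ (F : ℕ → Ω → ℝ) (_ : IsMonotoneCover V (s i) F),
              ⨆ n, ENNReal.ofReal (E (F n))) + δ i) :=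
            Finset.sum_le_sum fun i _ =>
              (le_iSup (fun n => ENNReal.ofReal (E (F i n))) n).trans (hle i)
        _ ≤ _ := ENNReal.sum_le_tsum _
        _ = _ := ENNReal.tsum_add
        _ ≤ _ := by gcongr

variable {V : Submodule ℝ (Ω → ℝ)} {E : (Ω → ℝ) →ₗ[ℝ] ℝ}

theorem daniellOuter_le {A : Set Ω} {F : ℕ → Ω → ℝ} (hF : IsMonotoneCover V A F) :
    daniellOuter V E A ≤ ⨆ n, ENNReal.ofReal (E (F n)) :=
  iInf₂_le F hF

namespace IsDaniell

theorem mono (h : IsDaniell V E) {f g : Ω → ℝ} (hf : f ∈ V) (hg : g ∈ V) (hfg : f ≤ g) :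
    E f ≤ E g := by
  have := h.map_nonneg (g - f) (V.sub_mem hg hf) (sub_nonneg.2 hfg)
  rw [map_sub] at this
  linarith

theorem const_mem (h : IsDaniell V E) (c : ℝ) : (fun _ => c : Ω → ℝ) ∈ V := by
  have := V.smul_mem c h.one_mem
  convert this using 1
  ext; simp

theorem map_const (h : IsDaniell V E) (c : ℝ) : E (fun _ => c) = c := by
  have : (fun _ => c : Ω → ℝ) = c • (1 : Ω → ℝ) := by ext; simp
  rw [this, map_smul, h.map_one, smul_eq_mul, mul_one]

/-- For a cover `F` of `A`, the functions `(g - F n)⁺` decrease to `0`: on `A` because eventually `g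
≤ 1 ≤ F n`, off `A` because `g ≤ 0 ≤ F n`. Continuity at `0` enters the construction only here. -/
theorem le_daniellOuter (h : IsDaniell V E) {A : Set Ω} {g : Ω → ℝ} (hg : g ∈ V)
    (hg_one : ∀ ω, g ω ≤ 1) (hg_zero : ∀ ω ∉ A, g ω ≤ 0) :
    ENNReal.ofReal (E g) ≤ daniellOuter V E A := by
  refine le_iInf₂ fun F hF => ?_
  have hmem : ∀ n, (g - F n) ⊔ 0 ∈ V := fun n =>
    h.sup_mem _ (V.sub_mem hg (hF.mem n)) _ V.zero_mem
  have hlim : Tendsto (fun n => E ((g - F n) ⊔ 0)) atTop (𝓝 0) := by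
    refine h.tendsto_zero _ hmem (fun m n hmn => ?_) fun ω => ?_
    · exact sup_le_sup_right (sub_le_sub_left (hF.mono hmn) g) 0
    · refine tendsto_const_nhds.congr' ?_
      by_cases hω : ω ∈ A
      · obtain ⟨n, hn⟩ := hF.one_le ω hω
        filter_upwards [eventually_ge_atTop n] with m hm
        have h1 := hF.mono hm ω
        have h2 := hg_one ω
        simp only [Pi.sup_apply, Pi.sub_apply, Pi.zero_apply]
        exact (max_eq_right (by linarith)).symm
      · refine Eventually.of_forall fun m => ?_
        have h1 := hF.nonneg m ω
        have h2 := hg_zero ω hω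
        simp only [Pi.sup_apply, Pi.sub_apply, Pi.zero_apply] at h1 ⊢
        exact (max_eq_right (by linarith)).symm
  have hlim' : Tendsto (fun n => (⨆ n, ENNReal.ofReal (E (F n)))
      + ENNReal.ofReal (E ((g - F n) ⊔ 0))) atTop (𝓝 (⨆ n, ENNReal.ofReal (E (F n)))) := by
    have := (ENNReal.tendsto_ofReal hlim).const_add (⨆ n, ENNReal.ofReal (E (F n)))
    simpa using this
  refine ge_of_tendsto' hlim' fun n => ?_
  have h1 : E g ≤ E (F n) + E ((g - F n) ⊔ 0) := by
    rw [← map_add]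
    refine h.mono hg (V.add_mem (hF.mem n) (hmem n)) ?_
    have : g - F n ≤ (g - F n) ⊔ 0 := le_sup_left
    exact sub_le_iff_le_add'.1 this
  exact (ENNReal.ofReal_le_ofReal h1).trans (ENNReal.ofReal_add_le.trans
    (add_le_add (le_iSup (fun n => ENNReal.ofReal (E (F n))) n) le_rfl))

/-- The truncations `φ k = 1 ⊓ k f⁺` increase to the indicator of the set. They split a cover `F` of
`t` into `F k ⊓ φ k` for the inside and, with `k` frozen to keep monotonicity in `n`, `F n - F n ⊓ φ
k` for the outside. Together these are at most `F (max n k)`. -/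
theorem isCaratheodory_pos (h : IsDaniell V E) {f : Ω → ℝ} (hf : f ∈ V) :
    MeasurableSet[(daniellOuter V E).caratheodory] {ω | 0 < f ω} := by
  rw [OuterMeasure.isCaratheodory_iff_le]
  refine fun t => le_iInf₂ fun F hF => ?_
  let φ : ℕ → Ω → ℝ := fun k => 1 ⊓ ((k : ℝ) • (f ⊔ 0))
  have hφV : ∀ k, φ k ∈ V := fun k =>
    h.inf_mem _ h.one_mem _ (V.smul_mem _ (h.sup_mem _ hf _ V.zero_mem))
  have hfpos : (0 : Ω → ℝ) ≤ f ⊔ 0 := le_sup_right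
  have hφ0 : ∀ k, 0 ≤ φ k := fun k =>
    le_inf zero_le_one (smul_nonneg k.cast_nonneg hfpos)
  have hφmono : Monotone φ := fun m n hmn =>
    inf_le_inf_left _ (smul_le_smul_of_nonneg_right (Nat.cast_le.2 hmn) hfpos)
  have hu : IsMonotoneCover V (t ∩ {ω | 0 < f ω}) fun k => F k ⊓ φ k := by
    refine ⟨fun k => h.inf_mem _ (hF.mem k) _ (hφV k), fun k => le_inf (hF.nonneg k) (hφ0 k),
      fun m n hmn => inf_le_inf (hF.mono hmn) (hφmono hmn), ?_⟩
    rintro ω ⟨hωt, hω⟩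
    obtain ⟨n, hn⟩ := hF.one_le ω hωt
    obtain ⟨k, hk⟩ := exists_nat_ge (1 / f ω)
    refine ⟨max n k, le_inf (hn.trans (hF.mono (le_max_left n k) ω)) ?_⟩
    refine le_trans ?_ (hφmono (le_max_right n k) ω)
    have h1 : 1 ≤ (k : ℝ) * f ω := (div_le_iff₀ hω).1 hk
    refine le_inf le_rfl (h1.trans ?_)
    simp only [Pi.smul_apply, Pi.sup_apply, Pi.zero_apply, smul_eq_mul]
    exact mul_le_mul_of_nonneg_left (le_max_left _ _) k.cast_nonneg
  have hv : ∀ k, IsMonotoneCover V (t \ {ω | 0 < f ω}) fun n => F n - F n ⊓ φ k := by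
    intro k
    refine ⟨fun n => V.sub_mem (hF.mem n) (h.inf_mem _ (hF.mem n) _ (hφV k)),
      fun n => sub_nonneg.2 inf_le_left, fun m n hmn ω => ?_, ?_⟩
    · have := hF.mono hmn ω
      simp only [Pi.sub_apply, Pi.inf_apply]
      rcases le_total (F m ω) (φ k ω) with h1 | h1 <;>
        rcases le_total (F n ω) (φ k ω) with h2 | h2 <;> simp only [h1, h2, inf_of_le_left,
          inf_of_le_right] <;> linarith
    · rintro ω ⟨hωt, hω⟩
      obtain ⟨n, hn⟩ := hF.one_le ω hωt
      refine ⟨n, ?_⟩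
      have h1 : φ k ω = 0 := by
        have : f ω ≤ 0 := not_lt.1 hω
        simp [φ, this]
      simp only [Pi.sub_apply, Pi.inf_apply, h1]
      have h2 : min (F n ω) 0 = 0 := inf_of_le_right (hF.nonneg n ω)
      rwa [h2, sub_zero]
  refine (add_le_add (daniellOuter_le hu) le_rfl).trans ?_
  rw [ENNReal.iSup_add]
  refine iSup_le fun k => (add_le_add le_rfl (daniellOuter_le (hv k))).trans ?_
  rw [ENNReal.add_iSup]
  refine iSup_le fun n => ?_
  rw [← ENNReal.ofReal_add (h.map_nonneg _ (hu.mem k) (hu.nonneg k))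
    (h.map_nonneg _ ((hv k).mem n) ((hv k).nonneg n))]
  refine le_trans (ENNReal.ofReal_le_ofReal ?_)
    (le_iSup (fun n => ENNReal.ofReal (E (F n))) (max n k))
  rw [← map_add]
  refine h.mono (V.add_mem (hu.mem k) ((hv k).mem n)) (hF.mem _) ?_
  have h1 : F k ⊓ φ k ≤ F (max n k) ⊓ φ k := inf_le_inf_right _ (hF.mono (le_max_right n k))
  have h2 := (hv k).mono (le_max_left n k)
  exact (add_le_add h1 h2).trans (by simp)

/-- The sets `{a < f} = {0 < f - a}` generate, and `V` contains constants. -/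
theorem le_caratheodory (h : IsDaniell V E) :
    (⨆ f ∈ V, MeasurableSpace.comap f (borel ℝ)) ≤ (daniellOuter V E).caratheodory := by
  refine iSup₂_le fun f hf => ?_
  rw [borel_eq_generateFrom_Ioi, MeasurableSpace.comap_generateFrom]
  refine MeasurableSpace.generateFrom_le ?_
  rintro _ ⟨_, ⟨a, rfl⟩, rfl⟩
  have := h.isCaratheodory_pos (V.sub_mem hf (h.const_mem a))
  convert this using 1
  ext ω
  simp

/-- **Daniell's theorem**: a Daniell integral of total mass one on a Stonean vector lattice of
bounded functions is the integral against a probability measure. -/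
theorem exists_measure [mΩ : MeasurableSpace Ω] (h : IsDaniell V E)
    (hσ : (⨆ f ∈ V, MeasurableSpace.comap f (borel ℝ)) = mΩ)
    (hb : ∀ f ∈ V, ∃ C, ∀ ω, |f ω| ≤ C) :
    ∃ μ : Measure Ω, IsProbabilityMeasure μ ∧ ∀ f ∈ V, ∫ ω, f ω ∂μ = E f := by
  have hle : mΩ ≤ (daniellOuter V E).caratheodory := hσ ▸ h.le_caratheodory
  have hmeas : ∀ f ∈ V, Measurable f := fun f hf => by
    have : MeasurableSpace.comap f (borel ℝ) ≤ mΩ :=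
      hσ ▸ le_iSup₂ (f := fun f (_ : f ∈ V) => MeasurableSpace.comap f (borel ℝ)) f hf
    rw [measurable_iff_comap_le, BorelSpace.measurable_eq (α := ℝ)]
    exact this
  let μ := (daniellOuter V E).toMeasure hle
  have hμ : IsProbabilityMeasure μ := by
    constructor
    rw [toMeasure_apply _ _ MeasurableSet.univ]
    refine le_antisymm ?_ ?_
    · refine (daniellOuter_le (F := fun _ => 1) ⟨fun _ => h.one_mem, fun _ => zero_le_one,
        monotone_const, fun _ _ => ⟨0, le_rfl⟩⟩).trans ?_
      simp [h.map_one]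
    · simpa [h.map_one] using h.le_daniellOuter (A := univ) h.one_mem (fun _ => le_rfl) (by simp)
  have hint : ∀ f ∈ V, Integrable f μ := fun f hf => by
    obtain ⟨C, hC⟩ := hb f hf
    exact Integrable.of_bound (hmeas f hf).aestronglyMeasurable C (ae_of_all _ hC)
  have hlower : ∀ (A : Set Ω) (g : Ω → ℝ), MeasurableSet A → g ∈ V → (∀ ω, g ω ≤ 1) →
      (∀ ω ∉ A, g ω ≤ 0) → E g ≤ μ.real A := by
    intro A g hA hg h1 h0
    have := h.le_daniellOuter hg h1 h0
    rw [← toMeasure_apply _ hle hA] at this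
    exact (ENNReal.ofReal_le_iff_le_toReal (measure_ne_top μ A)).1 this
  -- Approximation by step functions with `N` levels.
  have hunit : ∀ g ∈ V, (∀ ω, 0 ≤ g ω) → (∀ ω, g ω ≤ 1) → E g ≤ ∫ ω, g ω ∂μ := by
    intro g hg g0 g1
    have key : ∀ N : ℕ, 0 < N → E g ≤ ∫ ω, g ω ∂μ + 1 / N := by
      intro N hN
      have hN' : (0 : ℝ) < N := Nat.cast_pos.2 hN
      let q : ℕ → Ω → ℝ := fun i => g ⊓ fun _ => (i : ℝ) / N
      have hq : ∀ i, q i ∈ V := fun i => h.inf_mem _ hg _ (h.const_mem _)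
      let A : ℕ → Set Ω := fun i => {ω | (i : ℝ) / N < g ω}
      have hA : ∀ i, MeasurableSet (A i) := fun i =>
        measurableSet_lt measurable_const (hmeas g hg)
      -- The slice `N (q (i + 1) - q i)` is at most `1` everywhere and nonpositive off `A i`, so
      -- `hlower` applies. The slices telescope to `g`.
      have hp : ∀ i, E (q (i + 1)) - E (q i) ≤ μ.real (A i) / N := by
        intro i
        rw [le_div_iff₀ hN', mul_comm, ← map_sub, ← smul_eq_mul, ← map_smul]
        refine hlower _ _ (hA i) (V.smul_mem _ (V.sub_mem (hq _) (hq _))) (fun ω => ?_)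
          fun ω hω => ?_
        · simp only [q, Pi.smul_apply, Pi.sub_apply, Pi.inf_apply, smul_eq_mul]
          rw [← le_div_iff₀' hN']
          have e : ((i + 1 : ℕ) : ℝ) / N = i / N + 1 / N := by push_cast; ring
          rcases le_total (g ω) ((i : ℝ) / N) with h1 | h1
          · have h2 : (0 : ℝ) ≤ 1 / N := by positivity
            rw [inf_of_le_left h1]
            have := inf_le_left (a := g ω) (b := ((i + 1 : ℕ) : ℝ) / N)
            linarith
          · rw [inf_of_le_right h1]
            have := inf_le_right (a := g ω) (b := ((i + 1 : ℕ) : ℝ) / N)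
            linarith
        · have h1 : g ω ≤ (i : ℝ) / N := not_lt.1 hω
          simp only [q, Pi.smul_apply, Pi.sub_apply, Pi.inf_apply, smul_eq_mul]
          rw [inf_of_le_left h1]
          have := inf_le_left (a := g ω) (b := ((i + 1 : ℕ) : ℝ) / N)
          exact mul_nonpos_of_nonneg_of_nonpos hN'.le (by linarith)
      have hqN : q N = g := by
        ext ω
        simp only [q, Pi.inf_apply]
        rw [div_self hN'.ne', inf_of_le_left (g1 ω)]
      have hq0 : q 0 = 0 := by
        ext ω
        simp [q, g0 ω]
      have htel : E g = ∑ i ∈ Finset.range N, (E (q (i + 1)) - E (q i)) := by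
        rw [Finset.sum_range_sub (fun i => E (q i)), hqN, hq0, map_zero, sub_zero]
      have hsum : ∑ i ∈ Finset.range N, μ.real (A i) / N
          = ∫ ω, ∑ i ∈ Finset.range N, (A i).indicator (fun _ => (1 : ℝ) / N) ω ∂μ := by
        rw [integral_finsetSum _ fun i _ => (integrable_const _).indicator (hA i)]
        refine Finset.sum_congr rfl fun i _ => ?_
        rw [integral_indicator_const _ (hA i), smul_eq_mul, mul_one_div]
      -- At most `⌈N g ω⌉ ≤ N g ω + 1` levels lie strictly below `g ω`; rounding up costs the `1 /
      -- N`.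
      have hpt : ∀ ω, ∑ i ∈ Finset.range N, (A i).indicator (fun _ => (1 : ℝ) / N) ω
          ≤ g ω + 1 / N := by
        intro ω
        classical
        simp only [indicator_apply]
        rw [← Finset.sum_filter, Finset.sum_const, nsmul_eq_mul]
        have hsub : (Finset.range N).filter (fun i => ω ∈ A i) ⊆
            Finset.range ⌈(N : ℝ) * g ω⌉₊ := by
          intro i hi
          have h1 : (i : ℝ) / N < g ω := (Finset.mem_filter.1 hi).2
          rw [div_lt_iff₀' hN'] at h1
          exact Finset.mem_range.2 (Nat.lt_ceil.2 h1)
        have hcard := Finset.card_le_card hsub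
        rw [Finset.card_range] at hcard
        have hceil := Nat.ceil_lt_add_one (mul_nonneg hN'.le (g0 ω))
        have hcard' : (((Finset.range N).filter (fun i => ω ∈ A i)).card : ℝ) ≤ N * g ω + 1 :=
          (Nat.cast_le.2 hcard).trans hceil.le
        rw [mul_one_div, div_le_iff₀ hN', add_mul, one_div_mul_cancel hN'.ne']
        linarith
      calc E g ≤ ∑ i ∈ Finset.range N, μ.real (A i) / N := by
            rw [htel]; exact Finset.sum_le_sum fun i _ => hp i
        _ ≤ ∫ ω, (g ω + 1 / N) ∂μ := by
            rw [hsum]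
            exact integral_mono (integrable_finsetSum _ fun i _ =>
              (integrable_const _).indicator (hA i)) ((hint g hg).add (integrable_const _)) hpt
        _ = _ := by
            rw [integral_add (hint g hg) (integrable_const _)]
            simp
    have hlim : Tendsto (fun N : ℕ => ∫ ω, g ω ∂μ + 1 / (N : ℝ)) atTop (𝓝 (∫ ω, g ω ∂μ)) := by
      simpa using tendsto_one_div_atTop_nhds_zero_nat.const_add (∫ ω, g ω ∂μ)
    refine ge_of_tendsto hlim ?_
    filter_upwards [eventually_gt_atTop 0] with N hN using key N hN
  have hle_int : ∀ f ∈ V, E f ≤ ∫ ω, f ω ∂μ := by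
    intro f hf
    obtain ⟨C', hC'⟩ := hb f hf
    obtain ⟨C, hC, hC0⟩ : ∃ C, (∀ ω, |f ω| ≤ C) ∧ 0 < C :=
      ⟨max C' 1, fun ω => (hC' ω).trans (le_max_left _ _), by positivity⟩
    -- The affine map `(f + C) / (2C)` carries `[-C, C]` onto `[0, 1]`.
    have := hunit ((2 * C)⁻¹ • (f + fun _ => C)) (V.smul_mem _ (V.add_mem hf (h.const_mem C)))
      (fun ω => by
        have := abs_le.1 (hC ω)
        simp only [Pi.smul_apply, Pi.add_apply, smul_eq_mul]
        exact mul_nonneg (by positivity) (by linarith))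
      (fun ω => by
        have := abs_le.1 (hC ω)
        simp only [Pi.smul_apply, Pi.add_apply, smul_eq_mul]
        rw [inv_mul_le_iff₀ (by positivity)]
        linarith)
    rw [map_smul, map_add, h.map_const] at this
    simp only [Pi.smul_apply, Pi.add_apply, smul_eq_mul] at this
    rw [integral_const_mul, integral_add (hint f hf) (integrable_const _)] at this
    have := le_of_mul_le_mul_left this (by positivity)
    simpa using this
  refine ⟨μ, hμ, fun f hf => le_antisymm ?_ (hle_int f hf)⟩
  -- Both sides are linear, so the one-sided bound for `-f` gives the other inequality.
  have := hle_int (-f) (V.neg_mem hf)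
  rw [map_neg] at this
  simp only [Pi.neg_apply, integral_neg] at this
  linarith

end IsDaniell

end Daniell

/-! ### Representing functionals on `M` by unique measures -/

section Representation

variable {Ω : Type*} [MeasurableSpace Ω]

/-- The inclusion of the bounded measurable functions into all functions. -/
def LInfty.coeLinear (Ω : Type*) [MeasurableSpace Ω] : LInfty Ω →ₗ[ℝ] (Ω → ℝ) where
  toFun f := f
  map_add' _ _ := rfl
  map_smul' _ _ := rfl

theorem LInfty.coeLinear_injective : Function.Injective (LInfty.coeLinear Ω) :=
  fun _ _ h => LInfty.ext (congrFun h)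

theorem generatedSigma_eq_iSup_map (M : Submodule ℝ (LInfty Ω)) :
    (⨆ f ∈ M.map (LInfty.coeLinear Ω), MeasurableSpace.comap f (borel ℝ)) = generatedSigma M := by
  refine le_antisymm (iSup₂_le ?_) (iSup₂_le fun f hf => ?_)
  · rintro _ ⟨f, hf, rfl⟩
    exact le_iSup₂ (f := fun (f : LInfty Ω) (_ : f ∈ M) =>
      MeasurableSpace.comap (f : Ω → ℝ) (borel ℝ)) f hf
  · exact le_iSup₂ (f := fun (f : Ω → ℝ) (_ : f ∈ M.map (LInfty.coeLinear Ω)) =>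
      MeasurableSpace.comap f (borel ℝ)) (f : Ω → ℝ) ⟨f, hf, rfl⟩

/-- A linear pre-expectation which is continuous from above is a probability measure. -/
theorem exists_probabilityMeasure_of_continuousFromAbove {M : Submodule ℝ (LInfty Ω)}
    (hone : LInfty.const Ω 1 ∈ M) (hriesz : IsRieszSubspace M)
    (hσ : generatedSigma M = ‹MeasurableSpace Ω›) {μ : WeakDual ℝ M}
    (hμ : μ ∈ linearPreExpectations M) (hcont : ContinuousFromAbove (fun X : M => μ X)) :
    ∃ ν : ProbabilityMeasure Ω, ∀ X : M, ∫ ω, (X : LInfty Ω) ω ∂(ν : Measure Ω) = μ X := by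
  -- `IsDaniell` wants a functional on all functions. Composing with a linear left inverse of the
  -- inclusion extends `μ` arbitrarily; only its values on `M` matter.
  obtain ⟨g, hg⟩ := ((LInfty.coeLinear Ω).comp M.subtype).exists_leftInverse_of_injective
    (LinearMap.ker_eq_bot.2 (LInfty.coeLinear_injective.comp M.injective_subtype))
  let T : M →ₗ[ℝ] ℝ := (WeakDual.toStrongDual μ : M →L[ℝ] ℝ)
  have hE : ∀ X : M, (T.comp g) (X : LInfty Ω) = μ X := fun X =>
    congrArg T (LinearMap.congr_fun hg X)
  have hmem : ∀ f ∈ M.map (LInfty.coeLinear Ω), ∃ X : M, ((X : LInfty Ω) : Ω → ℝ) = f := by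
    rintro _ ⟨X, hX, rfl⟩
    exact ⟨⟨X, hX⟩, rfl⟩
  have hmem' : ∀ X : M, ((X : LInfty Ω) : Ω → ℝ) ∈ M.map (LInfty.coeLinear Ω) :=
    fun X => ⟨X, X.2, rfl⟩
  have hD : IsDaniell (M.map (LInfty.coeLinear Ω)) (T.comp g) := by
    refine ⟨⟨_, hone, rfl⟩, ?_, ?_, ?_, ?_, ?_⟩
    · rintro _ ⟨X, hX, rfl⟩ _ ⟨Y, hY, rfl⟩
      obtain ⟨Z, hZ, h⟩ := (hriesz X hX Y hY).1
      exact ⟨Z, hZ, funext h⟩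
    · rintro _ ⟨X, hX, rfl⟩ _ ⟨Y, hY, rfl⟩
      obtain ⟨Z, hZ, h⟩ := (hriesz X hX Y hY).2
      exact ⟨Z, hZ, funext h⟩
    · intro f hf h0
      obtain ⟨X, rfl⟩ := hmem f hf
      rw [hE]
      have := hμ.mono 0 X h0
      rwa [map_zero] at this
    · exact (hE ⟨_, hone⟩).trans (hμ.const 1 hone)
    · intro f hf hanti hlim
      choose X hX using fun n => hmem (f n) (hf n)
      obtain rfl : (fun n => ((X n : LInfty Ω) : Ω → ℝ)) = f := funext hX
      simp only [hE]
      rw [← map_zero μ]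
      exact (hcont X 0 (fun ω m n hmn => hanti hmn ω) hlim).2
  obtain ⟨ν, hν, h⟩ := hD.exists_measure ((generatedSigma_eq_iSup_map M).trans hσ) (by
    intro f hf
    obtain ⟨X, rfl⟩ := hmem f hf
    exact ⟨_, LInfty.abs_apply_le _⟩)
  exact ⟨⟨ν, hν⟩, fun X => (h _ (hmem' X)).trans (hE X)⟩

/-- Two probability measures with the same integrals on a generating Riesz subspace agree. -/
theorem probabilityMeasure_eq_of_forall_integral_eq {M : Submodule ℝ (LInfty Ω)}
    (hone : LInfty.const Ω 1 ∈ M) (hriesz : IsRieszSubspace M)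
    (hσ : generatedSigma M = ‹MeasurableSpace Ω›) {ν ν' : Measure Ω} [IsProbabilityMeasure ν]
    [IsProbabilityMeasure ν']
    (h : ∀ f ∈ M, ∫ ω, (f : LInfty Ω) ω ∂ν = ∫ ω, (f : LInfty Ω) ω ∂ν') : ν = ν' := by
  -- These sets form a π-system, since `{0 < f} ∩ {0 < g} = {0 < min f g}`.
  let C : Set (Set Ω) := {s | ∃ f ∈ M, s = {ω | 0 < (f : LInfty Ω) ω}}
  have hgen : ‹MeasurableSpace Ω› = MeasurableSpace.generateFrom C := by
    refine le_antisymm ?_ (MeasurableSpace.generateFrom_le ?_)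
    · refine hσ.symm.le.trans (iSup₂_le fun f hf => ?_)
      rw [borel_eq_generateFrom_Ioi, MeasurableSpace.comap_generateFrom]
      refine MeasurableSpace.generateFrom_le ?_
      rintro _ ⟨_, ⟨a, rfl⟩, rfl⟩
      refine MeasurableSpace.measurableSet_generateFrom
        ⟨f + (-a) • LInfty.const Ω 1, M.add_mem hf (M.smul_mem _ hone), ?_⟩
      ext ω
      rw [mem_ofPred_eq, LInfty.add_apply, LInfty.smul_apply, LInfty.const, LInfty.mk_apply,
        mul_one, ← sub_eq_add_neg, sub_pos]
      rfl
    · rintro _ ⟨f, _, rfl⟩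
      exact measurableSet_lt measurable_const f.measurable
  refine ext_of_generate_finite C hgen ?_ ?_ (by simp)
  · rintro _ ⟨f, hf, rfl⟩ _ ⟨g, hg, rfl⟩ -
    obtain ⟨k, hk, hkeq⟩ := (hriesz f hf g hg).1
    refine ⟨k, hk, ?_⟩
    ext ω
    simp [hkeq]
  · rintro _ ⟨f, hf, rfl⟩
    obtain ⟨p, hp, hpeq⟩ := (hriesz f hf 0 M.zero_mem).2
    -- The functions `min 1 (k f⁺)` lie in `M` and converge to the indicator of `{0 < f}`, so
    -- integrals over `M` determine the measure of that set.
    choose φ hφ hφeq using fun k : ℕ =>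
      (hriesz (LInfty.const Ω 1) hone ((k : ℝ) • p) (M.smul_mem _ hp)).1
    have hφ' : ∀ k ω, (φ k : LInfty Ω) ω = min 1 ((k : ℝ) * max ((f : LInfty Ω) ω) 0) := by
      intro k ω
      rw [hφeq, LInfty.smul_apply, hpeq]
      rfl
    have hA : MeasurableSet {ω | 0 < (f : LInfty Ω) ω} :=
      measurableSet_lt measurable_const f.measurable
    have hlim : ∀ (ρ : Measure Ω) [IsProbabilityMeasure ρ],
        Tendsto (fun k => ∫ ω, (φ k : LInfty Ω) ω ∂ρ) atTop
          (𝓝 (ρ.real {ω | 0 < (f : LInfty Ω) ω})) := by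
      intro ρ _
      rw [← integral_indicator_one hA]
      refine tendsto_integral_of_dominated_convergence (fun _ => (1 : ℝ))
        (fun k => (φ k).measurable.aestronglyMeasurable) (integrable_const _)
        (fun k => ae_of_all _ fun ω => ?_) (ae_of_all _ fun ω => ?_)
      · rw [hφ', Real.norm_eq_abs, abs_of_nonneg (by positivity)]
        exact min_le_left _ _
      · simp only [hφ']
        refine tendsto_const_nhds.congr' ?_
        by_cases hω : 0 < (f : LInfty Ω) ω
        · obtain ⟨n, hn⟩ := exists_nat_ge (1 / (f : LInfty Ω) ω)
          filter_upwards [eventually_ge_atTop n] with k hk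
          rw [indicator_of_mem (show ω ∈ {ω | 0 < (f : LInfty Ω) ω} from hω), max_eq_left hω.le,
            Pi.one_apply, min_eq_left]
          exact (div_le_iff₀ hω).1 (hn.trans (Nat.cast_le.2 hk))
        · refine Eventually.of_forall fun k => ?_
          rw [indicator_of_notMem (show ω ∉ {ω | 0 < (f : LInfty Ω) ω} from hω),
            max_eq_right (not_lt.1 hω)]
          simp
    have heq := tendsto_nhds_unique (hlim ν) (by
      simpa only [fun k => h (φ k) (hφ k)] using hlim ν')
    exact (measureReal_eq_measureReal_iff).1 heq

end Representation

/-! ### Coherent families and their limits -/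

section InverseLimit

variable {Ω Ω' Ω'' : Type*} [MeasurableSpace Ω] [MeasurableSpace Ω'] [MeasurableSpace Ω'']

theorem continuous_pushDual (φ : Ω → Ω') (hφ : Measurable φ) {M : Submodule ℝ (LInfty Ω)}
    {N : Submodule ℝ (LInfty Ω')} (h : ∀ f ∈ N, LInfty.comp φ hφ f ∈ M) :
    Continuous (pushDual φ hφ h) :=
  WeakDual.continuous_of_continuous_eval fun _ => WeakDual.eval_continuous _

variable {I S : Type*} [MeasurableSpace S]
  {M : ∀ J : FinIdx I, Submodule ℝ (LInfty (FinPow S J))}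

theorem pushDual_pushDual (hM : StableUnderProj M) {J K L : FinIdx I} (hKJ : K ≤ J) (hLK : L ≤ K)
    (μ : WeakDual ℝ (M J)) :
    pushDual (pr₂ S hLK) (measurable_pr₂ hLK) (hM K L hLK)
        (pushDual (pr₂ S hKJ) (measurable_pr₂ hKJ) (hM J K hKJ) μ) =
      pushDual (pr₂ S (hLK.trans hKJ)) (measurable_pr₂ _) (hM J L (hLK.trans hKJ)) μ :=
  rfl

/-- An element of one of the sets of a consistent family of weak* compact sets extends to a
consistent choice of elements. -/
theorem exists_consistent_family (hM : StableUnderProj M)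
    {Q : ∀ J : FinIdx I, Set (WeakDual ℝ (M J))} (hcompact : ∀ J, IsCompact (Q J))
    (hQ : ConsistentSets hM Q) {J₀ : FinIdx I} {μ₀ : WeakDual ℝ (M J₀)} (hμ₀ : μ₀ ∈ Q J₀) :
    ∃ x : ∀ J, WeakDual ℝ (M J), x J₀ = μ₀ ∧ (∀ J, x J ∈ Q J) ∧
      ∀ (J K : FinIdx I) (h : K ≤ J),
        pushDual (pr₂ S h) (measurable_pr₂ h) (hM J K h) (x J) = x K := by
  classical
  have hdir : ∀ J K : FinIdx I, ∃ L, J ≤ L ∧ K ≤ L := fun J K =>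
    ⟨⟨J.1 ∪ K.1, J.2.mono Finset.subset_union_left⟩, Finset.subset_union_left,
      Finset.subset_union_right⟩
  have hpush : ∀ {J K : FinIdx I} (h : K ≤ J) {μ}, μ ∈ Q J →
      pushDual (pr₂ S h) (measurable_pr₂ h) (hM J K h) μ ∈ Q K := fun {J K} h {μ} hμ =>
    hQ J K h ▸ mem_image_of_mem _ hμ
  have hlift : ∀ J : FinIdx I, J₀ ≤ J → ∃ μ ∈ Q J, ∀ h : J₀ ≤ J,
      pushDual (pr₂ S h) (measurable_pr₂ h) (hM J J₀ h) μ = μ₀ := fun J h => by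
    rw [← hQ J J₀ h] at hμ₀
    obtain ⟨μ, hμ, e⟩ := hμ₀
    exact ⟨μ, hμ, fun _ => e⟩
  have hne : ∀ K, (Q K).Nonempty := fun K => by
    obtain ⟨L, h0, hK⟩ := hdir J₀ K
    obtain ⟨μ, hμ, -⟩ := hlift L h0
    exact ⟨_, hpush hK hμ⟩
  choose y hy using hne
  -- Requiring coherence only between `J` and its subsets makes nonemptiness of `C J` a matter of
  -- lifting `μ₀` once.
  let C : FinIdx I → Set (∀ J, WeakDual ℝ (M J)) := fun J =>
    univ.pi Q ∩ ({x | x J₀ = μ₀} ∩ ⋂ (K : FinIdx I) (h : K ≤ J),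
      {x | pushDual (pr₂ S h) (measurable_pr₂ h) (hM J K h) (x J) = x K})
  have hclosed : ∀ J, IsClosed (C J) := fun J => by
    refine (isCompact_univ_pi hcompact).isClosed.inter ((isClosed_eq (continuous_apply _)
      continuous_const).inter (isClosed_iInter fun K => isClosed_iInter fun h => isClosed_eq
        ((continuous_pushDual _ _ _).comp (continuous_apply _)) (continuous_apply _)))
  have hanti : ∀ J J', J ≤ J' → C J' ⊆ C J := by
    rintro J J' h x ⟨hx, hx0, hxc⟩
    refine ⟨hx, hx0, mem_iInter₂.2 fun K hK => ?_⟩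
    have h1 := mem_iInter₂.1 hxc J h
    have h2 := mem_iInter₂.1 hxc K (hK.trans h)
    simp only [mem_ofPred_eq] at h1 h2 ⊢
    -- Both `x J` and `x K` are images of `x J'`, and the projections compose.
    rw [← h1, pushDual_pushDual, h2]
  obtain ⟨x, hx⟩ := IsCompact.nonempty_iInter_of_directed_nonempty_isCompact_isClosed
    (hι := ⟨J₀⟩) C
    (fun J K => by
      obtain ⟨L, hJ, hK⟩ := hdir J K
      exact ⟨L, hanti J L hJ, hanti K L hK⟩)
    (fun J => by
      obtain ⟨L, h0, hJ⟩ := hdir J₀ J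
      obtain ⟨μ, hμ, e⟩ := hlift L h0
      -- Witness: push a lift of `μ₀` in `Q L` down to all `K ≤ L`, and take any point of `Q K`
      -- elsewhere.
      refine Set.Nonempty.mono (hanti J L hJ) ⟨fun K => if h : K ≤ L then
        pushDual (pr₂ S h) (measurable_pr₂ h) (hM L K h) μ else y K, fun K _ => ?_, ?_,
          mem_iInter₂.2 fun K hK => ?_⟩
      · by_cases h : K ≤ L
        · simpa only [dif_pos h] using hpush h hμ
        · simpa only [dif_neg h] using hy K
      · simpa only [mem_ofPred_eq, dif_pos h0] using e h0
      · simp only [mem_ofPred_eq, dif_pos hK, dif_pos (le_refl L), pushDual_pushDual])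
    (fun J => (isCompact_univ_pi hcompact).inter_right
      ((isClosed_eq (continuous_apply _) continuous_const).inter
        (isClosed_iInter fun K => isClosed_iInter fun h => isClosed_eq
          ((continuous_pushDual _ _ _).comp (continuous_apply _)) (continuous_apply _))))
    hclosed
  have hx' := mem_iInter.1 hx
  exact ⟨x, (hx' J₀).2.1, fun J => (hx' J₀).1 J (mem_univ J),
    fun J K h => mem_iInter₂.1 (hx' J).2.2 K h⟩

/-- A consistent family of probability measures on the finite powers of a Polish space extends to
a probability measure on the infinite power. -/
theorem exists_probabilityMeasure_map_pr_eq [Nonempty I] [TopologicalSpace S] [PolishSpace S]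
    [BorelSpace S] (ν : ∀ J : FinIdx I, Measure (FinPow S J)) [∀ J, IsProbabilityMeasure (ν J)]
    (hν : ∀ (J K : FinIdx I) (h : K ≤ J), (ν J).map (pr₂ S h) = ν K) :
    ∃ ρ : ProbabilityMeasure (I → S), ∀ J, (ρ : Measure (I → S)).map (pr S J) = ν J := by
  classical
  obtain ⟨i₀⟩ := ‹Nonempty I›
  -- The projective family must also be defined at `∅`. Adjoining `i₀` and projecting back covers
  -- that case and, by consistency, returns `ν J` for nonempty `J`.
  let e : Finset I → FinIdx I := fun J => ⟨insert i₀ J, Finset.insert_nonempty _ _⟩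
  let P : ∀ J : Finset I, Measure (∀ _ : J, S) := fun J =>
    (ν (e J)).map (Finset.restrict₂ (π := fun _ => S) (Finset.subset_insert i₀ J))
  have hP : IsProjectiveMeasureFamily (α := fun _ => S) P := by
    intro J K hKJ
    have h : e K ≤ e J := Finset.insert_subset_insert i₀ hKJ
    have hm : ∀ {A B : Finset I} (h : A ⊆ B), Measurable (Finset.restrict₂ (π := fun _ => S) h) :=
      fun h => Finset.measurable_restrict₂ h
    refine Eq.trans ?_ (Measure.map_map (hm hKJ) (hm (Finset.subset_insert i₀ J))).symm
    refine (congrArg (Measure.map _) (hν (e J) (e K) h).symm).trans ?_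
    exact Measure.map_map (hm (Finset.subset_insert i₀ K)) (hm h)
  have hprob : ∀ J, IsProbabilityMeasure (P J) := fun J =>
    Measure.isProbabilityMeasure_map (Finset.measurable_restrict₂ _).aemeasurable
  obtain ⟨ρ, hρ⟩ := exists_isProjectiveLimit hP
  refine ⟨⟨ρ, hρ.isProbabilityMeasure⟩, fun J => (hρ J.1).trans ?_⟩
  exact hν (e J.1) J (Finset.subset_insert i₀ J.1)

end InverseLimit

/-! ### The robust extension theorem -/

theorem mainTheorem3 {I S : Type*} [Nonempty I]
    [TopologicalSpace S] [PolishSpace S] [MeasurableSpace S] [BorelSpace S]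
    (M : ∀ J : FinIdx I, Submodule ℝ (LInfty (FinPow S J)))
    (hM_one : ∀ J, LInfty.const (FinPow S J) 1 ∈ M J)
    (hM_riesz : ∀ J, IsRieszSubspace (M J))
    (hM_sigma : ∀ J, generatedSigma (M J) = MeasurableSpace.pi)
    (hM_proj : StableUnderProj M)
    (Q : ∀ J : FinIdx I, Set (WeakDual ℝ (M J)))
    (hQ_pre : ∀ J, Q J ⊆ linearPreExpectations (M J))
    (hQ_convex : ∀ J, Convex ℝ (Q J))
    (hQ_compact : ∀ J, IsCompact (Q J))
    (hQ_cont : ∀ J, ∀ μ ∈ Q J, ContinuousFromAbove (fun X : M J => μ X))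
    (hQ_consistent : ConsistentSets hM_proj Q) :
    ∃ P : Set (ProbabilityMeasure (I → S)),
      ∀ J : FinIdx I, pushMeasure (pr S J) (measurable_pr J) (M J) '' P = Q J := by
  refine ⟨{ρ | ∀ J, pushMeasure (pr S J) (measurable_pr J) (M J) ρ ∈ Q J}, fun J₀ => ?_⟩
  refine Subset.antisymm (image_subset_iff.2 fun ρ hρ => hρ J₀) fun μ₀ hμ₀ => ?_
  obtain ⟨x, hx0, hxQ, hxc⟩ := exists_consistent_family hM_proj hQ_compact hQ_consistent hμ₀
  choose ν hν using fun J => exists_probabilityMeasure_of_continuousFromAbove (hM_one J)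
    (hM_riesz J) (hM_sigma J) (hQ_pre J (hxQ J)) (hQ_cont J _ (hxQ J))
  obtain ⟨ρ, hρ⟩ := exists_probabilityMeasure_map_pr_eq (fun J => (ν J : Measure (FinPow S J)))
    fun J K h => by
      have : IsProbabilityMeasure ((ν J : Measure (FinPow S J)).map (pr₂ S h)) :=
        Measure.isProbabilityMeasure_map (measurable_pr₂ h).aemeasurable
      -- Testing against `M K` suffices, and there the two integrals are the values of the coherent
      -- functionals `x J` and `x K`.
      refine probabilityMeasure_eq_of_forall_integral_eq (hM_one K) (hM_riesz K) (hM_sigma K)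
        fun f hf => ?_
      rw [integral_map (measurable_pr₂ h).aemeasurable f.measurable.aestronglyMeasurable,
        hν K ⟨f, hf⟩, ← hxc J K h]
      exact hν J ⟨_, hM_proj J K h f hf⟩
  have hpush : ∀ J, pushMeasure (pr S J) (measurable_pr J) (M J) ρ = x J := fun J => by
    refine DFunLike.ext _ _ fun f => ?_
    rw [pushMeasure_apply, ← hν J f, ← hρ J, integral_map (measurable_pr J).aemeasurable
      (f : LInfty (FinPow S J)).measurable.aestronglyMeasurable]
  exact ⟨ρ, fun J => hpush J ▸ hxQ J, (hpush J₀).trans hx0⟩
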